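/- **Theorem.** Let $\Sigma$ be an alphabet with at least two letters. There are a family $(\mathcal A_n)_{n\ge 1}$ of nondeterministic Büchi automata over $\Sigma$, where $\mathcal A_n$ has exactly $n$ states, a constant $c>0$ and an $N$ such that for every $n\ge N$, every FDFW $\mathcal F$ over $\Sigma$ that accepts $\Sigma^\omega\setminus L(\mathcal A_n)$ has at least $2^{c\,n\log n}$ macrostates; that is, every such FDFW has $2^{\Omega(n\log n)}$ macrostates. Here a DFW is a finite automaton on finite words with exactly one initial state and at most one successor for each state and letter. An FDFW $\mathcal F=(\mathcal M,\{\mathcal N_q\})$ consists of a leading DFW $\mathcal M$ without accepting states and a progress DFW $\mathcal N_q$ for each state $q$ of $\mathcal M$; its macrostates are the states of $\mathcal M$ and of all the $\mathcal N_q$. An ultimately periodic word is a word $w=uv^\omega$ with $u\in\Sigma^*$ and $v\in\Sigma^+$; $(u,v)$ is then called a decomposition of $w$. It is accepted by $\mathcal F$ if $\mathcal M$ reaches the same state $q$ on $u$ and on $uv$, and $\mathcal N_q$ accepts $v$; the word $w$ is accepted by $\mathcal F$ if some decomposition of it is. $\mathcal F$ accepts an $\omega$-language $L$ if the ultimately periodic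 words that it accepts are exactly those in $L$. The FDFW is not required to be saturated. -/

import Mathlib

open Filter

/-! Automata on finite and infinite words. A nondeterministic automaton `(Q, I, δ, F)` over `α` is
`NFA α Q`, with `start = I`, `step = δ`, `accept = F`; an infinite word is a `Stream' α`. -/

/-- `ρ` is an infinite run of the automaton on `w`. -/
def NFA.IsOmegaRun {α σ : Type*} (A : NFA α σ) (w : Stream' α) (ρ : ℕ → σ) : Prop :=
  ρ 0 ∈ A.start ∧ ∀ i, ρ (i + 1) ∈ A.step (ρ i) (w.get i)

/-- The states that occur infinitely often in `ρ`. -/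
def infStates {σ : Type*} (ρ : ℕ → σ) : Set σ :=
  {q | ∃ᶠ i in atTop, ρ i = q}

/-- The language of infinite words of the automaton, read as a nondeterministic Büchi automaton. -/
def NFA.omegaLanguage {α σ : Type*} (A : NFA α σ) : Set (Stream' α) :=
  {w | ∃ ρ : ℕ → σ, A.IsOmegaRun w ρ ∧ (infStates ρ ∩ A.accept).Nonempty}

/-- Deterministic (possibly partial): exactly one initial state, and at most one successor for each
state and letter. -/
def NFA.IsDeterministic {α σ : Type*} (A : NFA α σ) : Prop :=
  (∃ q, A.start = {q}) ∧ ∀ q a, (A.step q a).Subsingleton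

/-- `(u, v)` is a decomposition of `w`: `v` is nonempty and `w = u v^ω`. -/
def IsDecomposition {α : Type*} (w : Stream' α) (u v : List α) : Prop :=
  ∃ hv : v ≠ [], w = u ++ₛ Stream'.cycle v hv

/-- The ultimately periodic words in a language of infinite words. -/
def upWords {α : Type*} (L : Set (Stream' α)) : Set (Stream' α) :=
  {w | w ∈ L ∧ ∃ u v, IsDecomposition w u v}

/-- A family of deterministic finite automata on words: a leading automaton without accepting
states, and a progress automaton for each of its states. -/
structure FDFW (α : Type*) where
  /-- the states of the leading automaton -/
  Lead : Type
  /-- the states of the progress automaton of a leading state -/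
  Prog : Lead → Type
  [fintypeLead : Fintype Lead]
  [fintypeProg : ∀ q, Fintype (Prog q)]
  leading : NFA α Lead
  progress : ∀ q, NFA α (Prog q)
  leading_deterministic : leading.IsDeterministic
  leading_accept : leading.accept = ∅
  progress_deterministic : ∀ q, (progress q).IsDeterministic

attribute [instance] FDFW.fintypeLead FDFW.fintypeProg

namespace FDFW

variable {α : Type*} (𝓕 : FDFW α)

/-- The number of macrostates: all states of the leading and of the progress automata. -/
def numMacrostates : ℕ :=
  Fintype.card 𝓕.Lead + ∑ q, Fintype.card (𝓕.Prog q)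

/-- `(u, v)` is normalized: the leading automaton reaches the same state on `u` and on `uv`. -/
def Normalized (u v : List α) : Prop :=
  𝓕.leading.eval u = 𝓕.leading.eval (u ++ v)

/-- `(u, v)` is captured: `v` is accepted by the progress automaton of the state reached on `u`. -/
def Captures (u v : List α) : Prop :=
  ∃ q, 𝓕.leading.eval u = {q} ∧ v ∈ (𝓕.progress q).accepts

/-- The ultimately periodic words that have a normalized and captured decomposition. -/
def upLanguage : Set (Stream' α) :=
  {w | ∃ u v, IsDecomposition w u v ∧ 𝓕.Normalized u v ∧ 𝓕.Captures u v}

/-- The family accepts `L` if it accepts exactly the ultimately periodic words in `L`. -/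
def Accepts (L : Set (Stream' α)) : Prop :=
  𝓕.upLanguage = upWords L

end FDFW

/-! ### Periodic infinite words -/

section Streams

variable {α : Type*}

/-! A token of `wheel (k + 2) b` keeps an index, the time minus its wheel position modulo `k + 2`,
and stands at the origin when the time is congruent to that index. A permutation `π` of `Fin k` is
written as a block of letters in which the `b` marking index `j` stands at a position congruent to
`j`, in the order given by `π`, with `bb` at the end. Since `bb` kills a pending search, a token can
be exchanged within a block only for one listed later. The indices `k` and `k + 1` are spare, so
that `bb` marks no element of `Fin k`. Repeating one order, a run can exchange tokens through
`active` only finitely often, so the word is rejected (`orderWord_notMem`). If two different orders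
recur forever, some pair `i`, `j` is listed both ways and can be exchanged back and forth, so the
word is accepted (`mem_wheel_of_frequently`).

An FDFW for the complement accepts each order word by some decomposition `(u, v)`. Let `P` be the
block length. Every sixth block is empty, which forces `6 * P` to divide the length of `v`; hence
cutting `v` after `3 * P` letters leaves a full nonempty block on either side. Record the leading
state after `u`, the leading and progress states at the cut, and the length of `u` modulo `6 * P`.
If two orders share this record, the first half of one period followed by the second half of the
other gives an accepted word that lists both orders forever, a contradiction. So `k! ≤ m ^ 2 * (6 *
P)` for `m` macrostates (`FDFW.factorial_le_of_accepts_wheel`), and taking logarithms gives the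
bound. -/

theorem Stream'.get_cycle (v : List α) (hv : v ≠ []) (i : ℕ) :
    (Stream'.cycle v hv).get i =
      v[i % v.length]'(Nat.mod_lt _ (List.length_pos_iff.2 hv)) := by
  induction i using Nat.strong_induction_on with
  | _ i ih =>
    have hpos := List.length_pos_iff.2 hv
    rcases lt_or_ge i v.length with h | h
    · rw [Stream'.cycle_eq, Stream'.get_append_left _ _ _ h]
      simp only [Nat.mod_eq_of_lt h]
    · obtain ⟨j, rfl⟩ := Nat.exists_eq_add_of_le h
      rw [Stream'.cycle_eq, Stream'.get_append_right, ih j (by omega)]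
      simp only [Nat.add_mod_left]

theorem IsDecomposition.get_add {w : Stream' α} {u v : List α} (h : IsDecomposition w u v) (s : ℕ) :
    w.get (u.length + s) = v[s % v.length]'(Nat.mod_lt _ (List.length_pos_iff.2 h.1)) := by
  obtain ⟨hv, rfl⟩ := h
  rw [Stream'.get_append_right, Stream'.get_cycle]

theorem isDecomposition_nil_take {w : Stream' α} {p : ℕ} (hp : 0 < p)
    (h : ∀ i, w.get i = w.get (i % p)) : IsDecomposition w [] (w.take p) := by
  have hne : w.take p ≠ [] := by
    rw [← List.length_pos_iff, Stream'.length_take]; exact hp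
  refine ⟨hne, ?_⟩
  rw [Stream'.nil_append_stream]
  ext i
  rw [Stream'.get_cycle, Stream'.take_get, h]
  simp only [Stream'.length_take]

end Streams

/-! ### Runs of Büchi automata -/

namespace NFA

variable {α σ τ : Type*}

/-- A ranking that never increases along transitions, and decreases whenever an accepting state is
entered, certifies that the word is rejected. -/
theorem notMem_omegaLanguage_of_rank (A : NFA α σ) (w : Stream' α) (φ : ℕ → σ → ℕ)
    (hle : ∀ i p q, q ∈ A.step p (w.get i) → φ (i + 1) q ≤ φ i p)
    (hlt : ∀ i p q, q ∈ A.step p (w.get i) → q ∈ A.accept → φ (i + 1) q < φ i p) :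
    w ∉ A.omegaLanguage := by
  rintro ⟨ρ, ⟨-, hstep⟩, q, hq, hacc⟩
  have hanti : Antitone fun i => φ i (ρ i) :=
    antitone_nat_of_succ_le fun i => hle i _ _ (hstep i)
  obtain ⟨n, hn⟩ : ∃ n, ∀ m, φ n (ρ n) ≤ φ m (ρ m) :=
    ⟨_, fun m => Function.argmin_le (fun i => φ i (ρ i)) m⟩
  obtain ⟨m, hm, rfl⟩ := frequently_atTop.1 hq (n + 1)
  obtain ⟨l, rfl⟩ : ∃ l, m = l + 1 := ⟨m - 1, by omega⟩
  have h1 := hlt l _ _ (hstep l) hacc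
  have h2 : φ l (ρ l) ≤ φ n (ρ n) := hanti (by omega)
  have h3 := hn (l + 1)
  omega

/-- Finite run segments that pass through one accepting state and can be prolonged forever compose
to an accepting run. -/
theorem mem_omegaLanguage_of_segments (A : NFA α σ) (w : Stream' α) (f : σ) (hf : f ∈ A.accept)
    (G : ℕ → σ → Prop) (p₀ : σ) (hp₀ : p₀ ∈ A.start) (hG : G 0 p₀)
    (h : ∀ i p, G i p → ∃ i' > i, ∃ ρ : ℕ → σ, ρ i = p ∧ G i' (ρ i') ∧
      (∀ l, i ≤ l → l < i' → ρ (l + 1) ∈ A.step (ρ l) (w.get l)) ∧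
      ∃ l, i ≤ l ∧ l < i' ∧ ρ l = f) :
    w ∈ A.omegaLanguage := by
  let C := {c : ℕ × σ // G c.1 c.2}
  have h' : ∀ c : C, ∃ i' > c.1.1, ∃ ρ : ℕ → σ, ρ c.1.1 = c.1.2 ∧ G i' (ρ i') ∧
      (∀ l, c.1.1 ≤ l → l < i' → ρ (l + 1) ∈ A.step (ρ l) (w.get l)) ∧
      ∃ l, c.1.1 ≤ l ∧ l < i' ∧ ρ l = f := fun c => h _ _ c.2
  choose next hnext seg hseg hGn hstep hvis using h'
  -- `g l` is the checkpoint that opens the segment in use at time `l`; the glued run reads its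
  -- state off that segment.
  let g : ℕ → C := fun l => Nat.rec (motive := fun _ => C) ⟨(0, p₀), hG⟩
    (fun l c => if l + 1 = next c then ⟨(next c, seg c (next c)), hGn c⟩ else c) l
  have gsucc : ∀ l, g (l + 1) =
      if l + 1 = next (g l) then ⟨(next (g l), seg (g l) (next (g l))), hGn (g l)⟩ else g l :=
    fun _ => rfl
  have inv : ∀ l, (g l).1.1 ≤ l ∧ l < next (g l) := by
    intro l
    induction l with
    | zero => exact ⟨le_rfl, hnext ⟨(0, p₀), hG⟩⟩
    | succ l ih =>
      rw [gsucc]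
      split_ifs with hl
      · refine ⟨hl.ge, ?_⟩
        have := hnext ⟨(next (g l), seg (g l) (next (g l))), hGn (g l)⟩
        exact hl.trans_lt this
      · omega
  have stay : ∀ l m, l ≤ m → m < next (g l) → g m = g l := by
    intro l m hlm
    induction m, hlm using Nat.le_induction with
    | base => exact fun _ => rfl
    | succ m hm ih =>
      intro hlt
      have hgm := ih (by omega)
      rw [gsucc, hgm, if_neg (by omega)]
  have runsucc : ∀ l, seg (g (l + 1)) (l + 1) = seg (g l) (l + 1) := by
    intro l
    by_cases hl : l + 1 = next (g l)
    · have e : g (l + 1) = ⟨(next (g l), seg (g l) (next (g l))), hGn (g l)⟩ := by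
        rw [gsucc, if_pos hl]
      have := hseg (g (l + 1))
      rw [e] at this ⊢
      simp only [← hl] at this ⊢
      exact this
    · rw [gsucc, if_neg hl]
  refine ⟨fun l => seg (g l) l, ⟨?_, fun l => ?_⟩, f, ?_, hf⟩
  · have : seg (g 0) 0 = p₀ := hseg (g 0)
    simpa only [this] using hp₀
  · simp only [runsucc]
    exact hstep (g l) l (inv l).1 (inv l).2
  · refine frequently_atTop.2 fun N => ?_
    set s := next (g N) with hs
    have hNs : N < s := (inv N).2
    have hgs : (g s).1.1 = s := by
      obtain ⟨t, ht⟩ : ∃ t, s = t + 1 := ⟨s - 1, by omega⟩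
      have : g t = g N := stay N t (by omega) (by omega)
      rw [ht, gsucc, this, if_pos (by omega)]
      simp only
      omega
    obtain ⟨l, hl1, hl2, hl3⟩ := hvis (g s)
    refine ⟨l, by omega, ?_⟩
    simp only [stay s l (by omega) hl2, hl3]

/-- The automaton transported along a renaming of the states. -/
def mapEquiv (A : NFA α σ) (e : σ ≃ τ) : NFA α τ where
  step p c := e.symm ⁻¹' A.step (e.symm p) c
  start := e.symm ⁻¹' A.start
  accept := e.symm ⁻¹' A.accept

theorem omegaLanguage_mapEquiv (A : NFA α σ) (e : σ ≃ τ) :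
    (A.mapEquiv e).omegaLanguage = A.omegaLanguage := by
  ext w
  constructor
  · rintro ⟨ρ, ⟨h0, hs⟩, q, hq, hacc⟩
    exact ⟨fun i => e.symm (ρ i), ⟨h0, hs⟩, e.symm q,
      Frequently.mono hq fun i hi => congrArg _ hi, hacc⟩
  · rintro ⟨ρ, ⟨h0, hs⟩, q, hq, hacc⟩
    refine ⟨fun i => e (ρ i), ⟨?_, fun i => ?_⟩, e q,
      Frequently.mono hq fun i hi => congrArg _ hi, ?_⟩
    · simpa [mapEquiv] using h0
    · simpa [mapEquiv] using hs i
    · simpa [mapEquiv] using hacc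

theorem IsDeterministic.subsingleton_evalFrom {A : NFA α σ} (hA : A.IsDeterministic) {S : Set σ}
    (hS : S.Subsingleton) (x : List α) : (A.evalFrom S x).Subsingleton := by
  induction x generalizing S with
  | nil => simpa using hS
  | cons c x ih =>
    rw [evalFrom_cons]
    refine ih fun p hp q hq => ?_
    obtain ⟨s, hs, hps⟩ := A.mem_stepSet.1 hp
    obtain ⟨t, ht, hqt⟩ := A.mem_stepSet.1 hq
    obtain rfl := hS hs ht
    exact hA.2 _ _ hps hqt

theorem evalFrom_empty (A : NFA α σ) (x : List α) : A.evalFrom ∅ x = ∅ := by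
  induction x with
  | nil => rfl
  | cons c x ih => rw [evalFrom_cons, stepSet_empty, ih]

theorem eval_append (A : NFA α σ) (x y : List α) :
    A.eval (x ++ y) = A.evalFrom (A.eval x) y :=
  A.evalFrom_append _ _ _

/-- A prefix of a word on which a deterministic automaton has a run leads to exactly one state. -/
theorem IsDeterministic.exists_eval_eq_singleton {A : NFA α σ} (hA : A.IsDeterministic)
    {x y : List α} (h : (A.eval (x ++ y)).Nonempty) : ∃ d, A.eval x = {d} := by
  have hsub : (A.eval x).Subsingleton := by
    obtain ⟨⟨q, hq⟩, -⟩ := id hA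
    exact hA.subsingleton_evalFrom (by rw [hq]; exact Set.subsingleton_singleton) x
  rcases hsub.eq_empty_or_singleton with h0 | h1
  · rw [eval_append, h0, evalFrom_empty] at h
    exact absurd h Set.not_nonempty_empty
  · exact h1

end NFA

/-! ### The wheel automaton -/

/-- States of the wheel automaton: a token on a wheel of size `K` that turns with every letter, and
two states `active` and `marked` in which the automaton looks for a new token. -/
inductive WheelState (K : ℕ)
  | token (x : ZMod K)
  | active
  | marked

namespace WheelState

/-- A wheel state is a token or one of two further states. -/
def equivOption (K : ℕ) : WheelState K ≃ Option (Option (ZMod K)) where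
  toFun
    | token x => some (some x)
    | active => some none
    | marked => none
  invFun
    | some (some x) => token x
    | some none => active
    | none => marked
  left_inv p := by cases p <;> rfl
  right_inv p := by rcases p with _ | _ | _ <;> rfl

/-- A wheel of size `K` yields `K + 2` states. -/
noncomputable def equivFin (K : ℕ) [NeZero K] : WheelState K ≃ Fin (K + 2) :=
  (equivOption K).trans (Fintype.equivFinOfCardEq (by simp))

end WheelState

open WheelState

/-- The wheel automaton. A token that reaches the origin when `b` is read may be exchanged, before
the next `bb`, for the token that is at the origin at a later occurrence of `b`. -/
def wheel {α : Type*} (K : ℕ) (b : α) : NFA α (WheelState K) where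
  step
    | token x, c => {p | p = token (x + 1) ∨ (x = 0 ∧ c = b ∧ p = marked)}
    | active, c => {p | (c ≠ b ∧ p = active) ∨ (c = b ∧ p = marked)}
    | marked, c => {p | c ≠ b ∧ (p = active ∨ p = token 2)}
  start := Set.range token
  accept := {active}

/-! ### Words that list an order -/

/-- The length of a block. -/
def blockLength (k : ℕ) : ℕ := (k + 2) * (k + 1)

/-- The position in a block at which the index `j` is marked. -/
def markPos {k : ℕ} (π : Equiv.Perm (Fin k)) (j : Fin k) : ℕ := (k + 2) * π j + j

/-- The marked positions of a block: one for each index, and the last two. -/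
def IsMark {k : ℕ} (π : Equiv.Perm (Fin k)) (t : ℕ) : Prop :=
  (∃ j, t = markPos π j) ∨ blockLength k ≤ t + 2

open Classical in
/-- The infinite word with the letter `b` at the marked positions of all blocks except every sixth,
and `a` elsewhere. -/
noncomputable def orderWord {α : Type*} (a b : α) {k : ℕ} (π : Equiv.Perm (Fin k)) : Stream' α :=
  fun i => if i / blockLength k % 6 ≠ 0 ∧ IsMark π (i % blockLength k) then b else a

section Marks

variable {k : ℕ} (π : Equiv.Perm (Fin k))

theorem markPos_lt (j : Fin k) : markPos π j + 4 < blockLength k := by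
  have h : (k + 2) * (π j : ℕ) + (k + 2) ≤ (k + 2) * k := by
    have := Nat.mul_le_mul_left (k + 2) (show (π j : ℕ) + 1 ≤ k by omega)
    linarith
  have h2 : blockLength k = (k + 2) * k + (k + 2) := by unfold blockLength; ring
  have := j.2
  unfold markPos
  omega

theorem two_le_blockLength : 2 ≤ blockLength k := by
  unfold blockLength; nlinarith

/-- This congruence ties marks to tokens: at the mark of `j`, the token at the origin is the one of
index `j`. -/
theorem markPos_mod (j : Fin k) : markPos π j % (k + 2) = j := by
  unfold markPos
  rw [Nat.mul_add_mod, Nat.mod_eq_of_lt (by omega)]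

theorem markPos_lt_markPos {i j : Fin k} (h : π i < π j) : markPos π i + 2 ≤ markPos π j := by
  have := Nat.mul_le_mul_left (k + 2) (show (π i : ℕ) + 1 ≤ π j from h)
  have := i.2
  unfold markPos
  linarith

theorem markPos_ne_succ (i j : Fin k) : markPos π i ≠ markPos π j + 1 := by
  intro h
  rcases lt_trichotomy (π i) (π j) with h1 | h1 | h1
  · have := markPos_lt_markPos π h1; omega
  · obtain rfl := π.injective h1; omega
  · have := markPos_lt_markPos π h1; omega

variable {π}

/-- Marks of different indices are at least two apart, so `bb` can occur inside a block only at its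
end, and a search started at an earlier mark survives the next letter. -/
theorem IsMark.not_succ {t : ℕ} (h : IsMark π t) (ht : t + 3 ≤ blockLength k) :
    ¬ IsMark π (t + 1) := by
  rcases h with ⟨j, rfl⟩ | h
  · rintro (⟨i, hi⟩ | h)
    · exact markPos_ne_succ π i j hi.symm
    · have := markPos_lt π j; omega
  · omega

theorem isMark_markPos (j : Fin k) : IsMark π (markPos π j) := Or.inl ⟨j, rfl⟩

end Marks

section Word

variable {α : Type*} {a b : α} {k : ℕ} (π : Equiv.Perm (Fin k))

theorem orderWord_eq_iff (hab : a ≠ b) (i : ℕ) :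
    (orderWord a b π).get i = b ↔
      i / blockLength k % 6 ≠ 0 ∧ IsMark π (i % blockLength k) := by
  simp only [Stream'.get, orderWord]
  split_ifs with h
  · simpa using h
  · simp only [hab, false_iff]; exact h

theorem orderWord_block_eq_iff (hab : a ≠ b) (m : ℕ) {t : ℕ} (ht : t < blockLength k) :
    (orderWord a b π).get (blockLength k * m + t) = b ↔ m % 6 ≠ 0 ∧ IsMark π t := by
  rw [orderWord_eq_iff π hab, Nat.mul_add_mod, Nat.mod_eq_of_lt ht,
    Nat.mul_add_div (by omega), Nat.div_eq_of_lt ht, add_zero]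

theorem orderWord_get_congr {i j : ℕ} (h : i ≡ j [MOD 6 * blockLength k]) :
    (orderWord a b π).get i = (orderWord a b π).get j := by
  have h1 : i % blockLength k = j % blockLength k := Nat.ModEq.of_mul_left 6 h
  have h2 : i / blockLength k % 6 = j / blockLength k % 6 := by
    rw [← Nat.mod_mul_right_div_self, ← Nat.mod_mul_right_div_self, mul_comm]
    exact congrArg (· / _) h
  unfold Stream'.get orderWord
  rw [h1, h2]

/-- The last marked letter before an empty block shows the phase of the word. -/
theorem orderWord_phase (hab : a ≠ b) {i : ℕ} :
    ((orderWord a b π).get i = b ∧ ∀ s < blockLength k, (orderWord a b π).get (i + 1 + s) ≠ b) ↔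
      6 * blockLength k ∣ i + 1 := by
  have hP := two_le_blockLength (k := k)
  set P := blockLength k with hPdef
  have hblock := fun m t ht => orderWord_block_eq_iff π hab m (t := t) (k := k) ht
  rw [← hPdef] at hblock
  constructor
  · rintro ⟨h1, h2⟩
    obtain ⟨m, t, ht, rfl⟩ : ∃ m t, t < P ∧ i = P * m + t :=
      ⟨i / P, i % P, Nat.mod_lt _ (by omega), (Nat.div_add_mod i P).symm⟩
    rw [hblock m t ht] at h1
    have hlast : t + 1 = P := by
      by_contra hne
      -- Otherwise the closing `b` of the same block would follow within `P` letters.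
      refine h2 (P - 1 - (t + 1)) (by omega) ?_
      rw [show P * m + t + 1 + (P - 1 - (t + 1)) = P * m + (P - 1) by omega,
        hblock _ _ (by omega)]
      exact ⟨h1.1, Or.inr (by omega)⟩
    have h3 := h2 (P - 1) (by omega)
    rw [show P * m + t + 1 + (P - 1) = P * (m + 1) + (P - 1) by rw [mul_add]; omega, Ne,
      hblock _ _ (by omega)] at h3
    have h4 : (m + 1) % 6 = 0 := by
      by_contra h4
      exact h3 ⟨h4, Or.inr (by omega)⟩
    rw [show P * m + t + 1 = (m + 1) * P by rw [add_mul, mul_comm]; omega]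
    exact Nat.mul_dvd_mul_right (Nat.dvd_of_mod_eq_zero h4) P
  · rintro ⟨m, hm⟩
    obtain ⟨l, rfl⟩ : ∃ l, m = l + 1 := by
      cases m with
      | zero => omega
      | succ l => exact ⟨l, rfl⟩
    have hi : i = P * (6 * l + 5) + (P - 1) := by
      have : 6 * P * (l + 1) = P * (6 * l + 5) + P := by ring
      omega
    constructor
    · rw [hi, hblock _ _ (by omega)]
      exact ⟨by omega, Or.inr (by omega)⟩
    · intro s hs
      rw [show i + 1 + s = P * (6 * (l + 1)) + s by rw [hm]; ring, Ne, hblock _ _ hs]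
      omega

/-- Every period of a tail of the word is a multiple of six block lengths. -/
theorem dvd_of_orderWord_period (hab : a ≠ b) {n p : ℕ}
    (h : ∀ i ≥ n, (orderWord a b π).get (i + p) = (orderWord a b π).get i) :
    6 * blockLength k ∣ p := by
  have hP := two_le_blockLength (k := k)
  set i := 6 * blockLength k * (n + 1) - 1 with hi
  have hle : n + 1 ≤ 6 * blockLength k * (n + 1) := Nat.le_mul_of_pos_left _ (by omega)
  have hdvd : 6 * blockLength k ∣ i + 1 := ⟨n + 1, by omega⟩
  have h1 := (orderWord_phase π hab).2 hdvd
  have h2 : 6 * blockLength k ∣ i + p + 1 := by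
    refine (orderWord_phase π hab).1 ⟨by rw [h i (by omega)]; exact h1.1, fun s hs => ?_⟩
    rw [show i + p + 1 + s = i + 1 + s + p by omega, h _ (by omega)]
    exact h1.2 s hs
  rw [show i + p + 1 = i + 1 + p by omega] at h2
  exact (Nat.dvd_add_right hdvd).1 h2

end Word

/-! ### Rejection of the order words by a ranking -/

section Rejection

variable {α : Type*} {a b : α} {k : ℕ} (π : Equiv.Perm (Fin k))

theorem natCast_blockLength_mul_add (m t : ℕ) :
    ((blockLength k * m + t : ℕ) : ZMod (k + 2)) = t := by
  have h : ((k + 2 : ℕ) : ZMod (k + 2)) = 0 := ZMod.natCast_self _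
  rw [blockLength, mul_assoc, Nat.cast_add, Nat.cast_mul, h, zero_mul, zero_add]

open Classical in
/-- A ranking of the runs of the wheel automaton on `orderWord a b π`. -/
noncomputable def orderRank (i : ℕ) : WheelState (k + 2) → ℕ
  | token x =>
    if h : ((i : ZMod (k + 2)) - x).val < k then blockLength k - markPos π ⟨_, h⟩
    else 4 * blockLength k
  | active =>
    if i / blockLength k % 6 = 0 then 3 * blockLength k - i % blockLength k
    else if i % blockLength k + 1 = blockLength k then 4 * blockLength k
    else blockLength k - i % blockLength k
  | marked =>
    if i / blockLength k % 6 ≠ 0 ∧ ∃ t, i % blockLength k = t + 1 ∧ IsMark π t then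
      blockLength k + 1 - i % blockLength k
    else 4 * blockLength k

theorem orderRank_token_le (i : ℕ) (x : ZMod (k + 2)) :
    orderRank π i (token x) ≤ 4 * blockLength k := by
  unfold orderRank; dsimp only; split_ifs <;> omega

theorem orderRank_marked_le (i : ℕ) : orderRank π i marked ≤ 4 * blockLength k := by
  have := two_le_blockLength (k := k)
  unfold orderRank; dsimp only; split_ifs <;> omega

theorem orderRank_token_of_eq {i : ℕ} {x : ZMod (k + 2)} {j : Fin k}
    (h : (i : ZMod (k + 2)) - x = (markPos π j : ℕ)) :
    orderRank π i (token x) = blockLength k - markPos π j := by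
  have hval : ((i : ZMod (k + 2)) - x).val = j := by
    rw [h, ZMod.val_natCast, markPos_mod]
  have hlt : ((i : ZMod (k + 2)) - x).val < k := hval ▸ j.2
  have hj : (⟨_, hlt⟩ : Fin k) = j := Fin.ext hval
  unfold orderRank
  dsimp only
  rw [dif_pos hlt, hj]

theorem orderRank_token_succ (i : ℕ) (x : ZMod (k + 2)) :
    orderRank π (i + 1) (token (x + 1)) = orderRank π i (token x) := by
  have h : (((i + 1 : ℕ) : ZMod (k + 2)) - (x + 1)) = i - x := by push_cast; ring
  unfold orderRank
  dsimp only
  simp only [h]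

theorem orderRank_active (m : ℕ) {t : ℕ} (ht : t < blockLength k) :
    orderRank π (blockLength k * m + t) active =
      if m % 6 = 0 then 3 * blockLength k - t
      else if t + 1 = blockLength k then 4 * blockLength k else blockLength k - t := by
  unfold orderRank
  dsimp only
  rw [Nat.mul_add_mod, Nat.mod_eq_of_lt ht, Nat.mul_add_div (by omega), Nat.div_eq_of_lt ht,
    add_zero]

theorem orderRank_marked_of_mark {m t : ℕ} (hm : m % 6 ≠ 0) (ht : t + 1 < blockLength k)
    (h : IsMark π t) :
    orderRank π (blockLength k * m + (t + 1)) marked = blockLength k - t := by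
  unfold orderRank
  dsimp only
  rw [Nat.mul_add_mod, Nat.mod_eq_of_lt ht, Nat.mul_add_div (by omega), Nat.div_eq_of_lt ht,
    add_zero, if_pos ⟨hm, t, rfl, h⟩]
  omega

theorem orderRank_marked_cases (m : ℕ) {t : ℕ} (ht : t < blockLength k) :
    orderRank π (blockLength k * m + t) marked = 4 * blockLength k ∨
      m % 6 ≠ 0 ∧ ∃ s, t = s + 1 ∧ IsMark π s := by
  unfold orderRank
  dsimp only
  rw [Nat.mul_add_mod, Nat.mod_eq_of_lt ht, Nat.mul_add_div (by omega), Nat.div_eq_of_lt ht,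
    add_zero]
  split_ifs with h
  · exact Or.inr h
  · exact Or.inl rfl

/-- The last two positions of a block have residues `k` and `k + 1`, so the token at the origin
there is a spare one. -/
theorem orderRank_token_zero_of_last (m : ℕ) {t : ℕ} (ht : t < blockLength k)
    (h : blockLength k ≤ t + 2) :
    orderRank π (blockLength k * m + t) (token 0) = 4 * blockLength k := by
  have hval : (((blockLength k * m + t : ℕ) : ZMod (k + 2)) - 0).val = t % (k + 2) := by
    rw [sub_zero, natCast_blockLength_mul_add, ZMod.val_natCast]
  have hP : blockLength k = (k + 2) * k + (k + 2) := by unfold blockLength; ring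
  obtain ⟨s, rfl, hs⟩ : ∃ s, t = (k + 2) * k + s ∧ k ≤ s ∧ s < k + 2 :=
    ⟨t - (k + 2) * k, by omega, by omega, by omega⟩
  rw [Nat.mul_add_mod, Nat.mod_eq_of_lt hs.2] at hval
  unfold orderRank
  dsimp only
  rw [dif_neg (by omega)]

/-- A token of index below `k` is ranked by the length of a block from its mark on, and a search in
a nonempty block by what remains of the block, so moving forward in the order lowers the rank. A
search in an empty block ranks above `2 * blockLength k`, which lets it carry over into the next
block. The top value `4 * blockLength k` is left for spare tokens and for search states not covered
by these cases. -/
theorem orderRank_step (hab : a ≠ b) (i : ℕ) (p q : WheelState (k + 2))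
    (h : q ∈ (wheel (k + 2) b).step p ((orderWord a b π).get i)) :
    orderRank π (i + 1) q ≤ orderRank π i p ∧
      (q = active → orderRank π (i + 1) q < orderRank π i p) := by
  have hP := two_le_blockLength (k := k)
  obtain ⟨m, t, ht, rfl⟩ : ∃ m t, t < blockLength k ∧ i = blockLength k * m + t :=
    ⟨i / blockLength k, i % blockLength k, Nat.mod_lt _ (by omega),
      (Nat.div_add_mod i _).symm⟩
  have hb := orderWord_block_eq_iff π hab m ht
  have hnext : t + 1 = blockLength k →
      blockLength k * m + t + 1 = blockLength k * (m + 1) + 0 := by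
    intro h; rw [mul_add]; omega
  cases p with
  | token x =>
    rcases h with rfl | ⟨rfl, hc, rfl⟩
    · exact ⟨(orderRank_token_succ π _ x).le, by simp⟩
    · refine ⟨?_, by simp⟩
      obtain ⟨hm, hmark⟩ := hb.1 hc
      rcases id hmark with ⟨j, hj⟩ | hlast
      · have := markPos_lt π j
        rw [add_assoc, orderRank_marked_of_mark π hm (by omega) hmark,
          orderRank_token_of_eq π (j := j), hj]
        rw [sub_zero, natCast_blockLength_mul_add, hj]
      · rw [orderRank_token_zero_of_last π m ht hlast]
        exact orderRank_marked_le π _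
  | active =>
    rcases h with ⟨hc, rfl⟩ | ⟨hc, rfl⟩
    · suffices orderRank π (blockLength k * m + t + 1) active <
        orderRank π (blockLength k * m + t) active from ⟨this.le, fun _ => this⟩
      rw [Ne, hb] at hc
      by_cases hm : m % 6 = 0
      · rw [orderRank_active π m ht, if_pos hm]
        by_cases hlast : t + 1 = blockLength k
        · rw [hnext hlast, orderRank_active π _ (by omega), if_neg (by omega),
            if_neg (by omega)]
          omega
        · rw [add_assoc, orderRank_active π _ (by omega), if_pos hm]
          omega
      · have h2 : ¬ blockLength k ≤ t + 2 := fun h => hc ⟨hm, Or.inr h⟩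
        rw [orderRank_active π m ht, if_neg hm, if_neg (by omega), add_assoc,
          orderRank_active π _ (by omega), if_neg hm, if_neg (by omega)]
        omega
    · refine ⟨?_, by simp⟩
      obtain ⟨hm, hmark⟩ := hb.1 hc
      rw [orderRank_active π m ht, if_neg hm]
      split_ifs with hlast
      · exact orderRank_marked_le π _
      · rw [add_assoc, orderRank_marked_of_mark π hm (by omega) hmark]
  | marked =>
    obtain ⟨hc, h⟩ := h
    rw [Ne, hb] at hc
    have hactive : orderRank π (blockLength k * m + t + 1) active < 4 * blockLength k ∧
        (m % 6 ≠ 0 → 1 ≤ t →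
          orderRank π (blockLength k * m + t + 1) active ≤ blockLength k - (t + 1)) := by
      by_cases hm : m % 6 = 0
      · refine ⟨?_, fun h => absurd hm h⟩
        by_cases hlast : t + 1 = blockLength k
        · rw [hnext hlast, orderRank_active π _ (by omega), if_neg (by omega),
            if_neg (by omega)]
          omega
        · rw [add_assoc, orderRank_active π _ (by omega), if_pos hm]
          omega
      · have h2 : ¬ blockLength k ≤ t + 2 := fun h => hc ⟨hm, Or.inr h⟩
        rw [add_assoc, orderRank_active π _ (by omega), if_neg hm, if_neg (by omega)]
        omega
    rcases orderRank_marked_cases π m ht with h4 | ⟨hm, s, rfl, hs⟩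
    · rw [h4]
      rcases h with rfl | rfl
      · exact ⟨hactive.1.le, fun _ => hactive.1⟩
      · exact ⟨orderRank_token_le π _ _, by simp⟩
    · have h2 : ¬ blockLength k ≤ s + 1 + 2 := fun h => hc ⟨hm, Or.inr h⟩
      rw [orderRank_marked_of_mark π hm ht hs]
      rcases h with rfl | rfl
      · have := hactive.2 hm (by omega)
        exact ⟨by omega, fun _ => by omega⟩
      · refine ⟨?_, by simp⟩
        rcases hs with ⟨j, rfl⟩ | hs
        · rw [orderRank_token_of_eq π (j := j)]
          rw [add_assoc, add_assoc, natCast_blockLength_mul_add]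
          push_cast
          ring
        · omega

theorem orderWord_notMem (hab : a ≠ b) :
    orderWord a b π ∉ (wheel (k + 2) b).omegaLanguage :=
  NFA.notMem_omegaLanguage_of_rank _ _ (orderRank π)
    (fun i p q h => (orderRank_step π hab i p q h).1)
    (fun i p q h hq => (orderRank_step π hab i p q h).2 hq)

end Rejection

/-! ### Acceptance when two orders recur -/

section Acceptance

variable {α : Type*} {a b : α} {k : ℕ}

open Classical in
/-- If infinitely often `w` lists `i` before `j` and infinitely often `j` before `i`, then the wheel
automaton accepts `w`. -/
theorem mem_wheel_of_frequently {w : Stream' α} {π σ : Equiv.Perm (Fin k)} {i j : Fin k}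
    (hπ : π i < π j) (hσ : σ j < σ i)
    (hwπ : ∀ N, ∃ m ≥ N, ∀ t < blockLength k, w.get (blockLength k * m + t) = b ↔ IsMark π t)
    (hwσ : ∀ N, ∃ m ≥ N, ∀ t < blockLength k, w.get (blockLength k * m + t) = b ↔ IsMark σ t) :
    w ∈ (wheel (k + 2) b).omegaLanguage := by
  have key : ∀ (π : Equiv.Perm (Fin k)) (i j : Fin k), π i < π j →
      (∀ N, ∃ m ≥ N, ∀ t < blockLength k, w.get (blockLength k * m + t) = b ↔ IsMark π t) →
      ∀ n, ∃ n' > n, ∃ ρ : ℕ → WheelState (k + 2), ρ n = token ((n : ZMod (k + 2)) - ((i : ℕ) : ZMod (k + 2))) ∧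
        ρ n' = token ((n' : ZMod (k + 2)) - ((j : ℕ) : ZMod (k + 2))) ∧
        (∀ l, n ≤ l → l < n' → ρ (l + 1) ∈ (wheel (k + 2) b).step (ρ l) (w.get l)) ∧
        ∃ l, n ≤ l ∧ l < n' ∧ ρ l = active := by
    intro π i j hij hw n
    obtain ⟨m, hm, hblock⟩ := hw n
    have hP := two_le_blockLength (k := k)
    have hmn : n ≤ blockLength k * m := hm.trans (Nat.le_mul_of_pos_left _ (by omega))
    have hi := markPos_lt π i
    have hj := markPos_lt π j
    have hle := markPos_lt_markPos π hij
    have cast_mark : ∀ j : Fin k,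
        ((blockLength k * m + markPos π j : ℕ) : ZMod (k + 2)) = (j : ℕ) := by
      intro j
      rw [natCast_blockLength_mul_add, ← ZMod.natCast_mod, markPos_mod]
    have hci := cast_mark i
    have hcj := cast_mark j
    generalize blockLength k * m = B at *
    generalize hTi : markPos π i = Ti at *
    generalize hTj : markPos π j = Tj at *
    have hmi : IsMark π Ti := hTi ▸ isMark_markPos i
    have hmj : IsMark π Tj := hTj ▸ isMark_markPos j
    -- Keep token `i` up to its mark, search from there to the mark of `j`, then carry token `j`.
    -- During the search the state is determined by the letter just read.
    let ρ : ℕ → WheelState (k + 2) := fun l =>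
      if l ≤ B + Ti then token ((l : ZMod (k + 2)) - ((i : ℕ) : ZMod (k + 2)))
      else if l ≤ B + Tj + 1 then (if w.get (l - 1) = b then marked else active)
      else token ((l : ZMod (k + 2)) - ((j : ℕ) : ZMod (k + 2)))
    have ρ1 : ∀ l, l ≤ B + Ti → ρ l = token ((l : ZMod (k + 2)) - ((i : ℕ) : ZMod (k + 2))) := fun l h => if_pos h
    have ρ2 : ∀ l, B + Ti ≤ l → l ≤ B + Tj →
        ρ (l + 1) = if w.get l = b then marked else active := by
      intro l h1 h2
      simp only [ρ]
      rw [if_neg (by omega), if_pos (by omega), Nat.add_sub_cancel]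
    have ρ3 : ∀ l, B + Tj + 1 < l → ρ l = token ((l : ZMod (k + 2)) - ((j : ℕ) : ZMod (k + 2))) := by
      intro l h
      simp only [ρ]
      rw [if_neg (by omega), if_neg (by omega)]
    have hb : ∀ t, t < Tj + 2 → (w.get (B + t) = b ↔ IsMark π t) :=
      fun t ht => hblock t (by omega)
    have hsucc : ∀ l, B + Ti ≤ l → l ≤ B + Tj → w.get l = b → w.get (l + 1) ≠ b := by
      intro l h1 h2
      obtain ⟨t, rfl⟩ := Nat.exists_eq_add_of_le (show B ≤ l by omega)
      rw [add_assoc, Ne, hb _ (by omega), hb _ (by omega)]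
      exact fun h => h.not_succ (by omega)
    -- Token `j` is available two letters after its mark. The state two letters after the mark of
    -- `i` is `active`, because the letter following that mark is not `b`.
    refine ⟨B + Tj + 2, by omega, ρ, ρ1 n (by omega), ρ3 _ (by omega), ?_, B + Ti + 2, by omega,
      by omega, ?_⟩
    · intro l _ hl
      rcases lt_trichotomy l (B + Ti) with h | h | h
      · rw [ρ1 l (by omega), ρ1 (l + 1) (by omega)]
        left
        congr 1
        push_cast
        ring
      · subst h
        rw [ρ1 _ le_rfl, ρ2 _ le_rfl (by omega), if_pos ((hb _ (by omega)).2 hmi)]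
        exact Or.inr ⟨by rw [hci, sub_self], (hb _ (by omega)).2 hmi, rfl⟩
      · obtain ⟨s, rfl⟩ : ∃ s, l = s + 1 := ⟨l - 1, by omega⟩
        rw [ρ2 s (by omega) (by omega)]
        by_cases hend : s = B + Tj
        · subst hend
          have hbj := (hb _ (by omega)).2 hmj
          rw [ρ3 _ (by omega), if_pos hbj]
          refine ⟨hsucc _ (by omega) le_rfl hbj, Or.inr ?_⟩
          congr 1
          push_cast at hcj ⊢
          rw [← hcj]
          ring
        · rw [ρ2 (s + 1) (by omega) (by omega)]
          by_cases hs : w.get s = b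
          · rw [if_pos hs, if_neg (hsucc s (by omega) (by omega) hs)]
            exact ⟨hsucc s (by omega) (by omega) hs, Or.inl rfl⟩
          · rw [if_neg hs]
            split_ifs with h'
            · exact Or.inr ⟨h', rfl⟩
            · exact Or.inl ⟨h', rfl⟩
    · rw [ρ2 (B + Ti + 1) (by omega) (by omega), if_neg]
      exact hsucc _ le_rfl (by omega) ((hb _ (by omega)).2 hmi)
  refine NFA.mem_omegaLanguage_of_segments _ w active rfl
    (fun n p => p = token ((n : ZMod (k + 2)) - ((i : ℕ) : ZMod (k + 2))) ∨ p = token ((n : ZMod (k + 2)) - ((j : ℕ) : ZMod (k + 2))))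
    (token (((0 : ℕ) : ZMod (k + 2)) - ((i : ℕ) : ZMod (k + 2)))) ⟨_, rfl⟩ (Or.inl rfl) ?_
  rintro n p (rfl | rfl)
  · obtain ⟨n', h1, ρ, h2, h3, h4⟩ := key π i j hπ hwπ n
    exact ⟨n', h1, ρ, h2, Or.inr h3, h4⟩
  · obtain ⟨n', h1, ρ, h2, h3, h4⟩ := key σ j i hσ hwσ n
    exact ⟨n', h1, ρ, h2, Or.inl h3, h4⟩

/-- Without such a pair, `σ ∘ π⁻¹` would be a strictly increasing bijection of `Fin k`, hence the
identity. -/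
theorem exists_lt_and_lt_of_ne {π σ : Equiv.Perm (Fin k)} (h : π ≠ σ) :
    ∃ i j, π i < π j ∧ σ j < σ i := by
  by_contra! hcon
  apply h
  have hmono : StrictMono fun x => σ (π.symm x) := by
    intro x y hxy
    refine lt_of_le_of_ne (hcon _ _ (by simpa using hxy)) fun he => hxy.ne ?_
    simpa using he
  have hid : (fun x => σ (π.symm x)) = id := by
    refine hmono.range_inj strictMono_id |>.1 ?_
    rw [Set.range_id]
    exact (σ.surjective.comp π.symm.surjective).range_eq
  ext x
  have := congrFun hid (π x)
  simp only [Equiv.symm_apply_apply, id] at this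
  rw [this]

end Acceptance

/-! ### The lower bound -/

section Splice

variable {α : Type*} {a b : α} {k : ℕ} {π σ : Equiv.Perm (Fin k)}

theorem IsDecomposition.dvd_length (hab : a ≠ b) {u v : List α}
    (h : IsDecomposition (orderWord a b π) u v) : 6 * blockLength k ∣ v.length := by
  refine dvd_of_orderWord_period π hab (n := u.length) fun i hi => ?_
  obtain ⟨s, rfl⟩ := Nat.exists_eq_add_of_le hi
  rw [add_assoc, h.get_add, h.get_add]
  simp only [Nat.add_mod_right]

theorem IsDecomposition.le_length (hab : a ≠ b) {u v : List α}
    (h : IsDecomposition (orderWord a b π) u v) : 6 * blockLength k ≤ v.length :=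
  Nat.le_of_dvd (List.length_pos_iff.2 h.1) (h.dvd_length hab)

/-- A window of three block lengths contains two consecutive complete blocks, and at most one of
them is empty. -/
theorem exists_block_between (k s : ℕ) :
    ∃ m, m % 6 ≠ 0 ∧ s ≤ blockLength k * m ∧
      blockLength k * m + blockLength k ≤ s + 3 * blockLength k := by
  have hP := two_le_blockLength (k := k)
  have h1 := Nat.div_add_mod s (blockLength k)
  have h2 := Nat.mod_lt s (show 0 < blockLength k by omega)
  by_cases h : (s / blockLength k + 1) % 6 = 0
  · exact ⟨s / blockLength k + 2, by omega, by rw [mul_add]; omega, by rw [mul_add]; omega⟩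
  · exact ⟨s / blockLength k + 1, h, by rw [mul_add]; omega, by rw [mul_add]; omega⟩

/-- Two words that list different orders, cut after three blocks of their periods and recombined,
give a word in the language of the wheel automaton. -/
theorem splice_mem_wheel (hab : a ≠ b) {u₁ v₁ u₂ v₂ : List α} (hne : π ≠ σ)
    (h₁ : IsDecomposition (orderWord a b π) u₁ v₁) (h₂ : IsDecomposition (orderWord a b σ) u₂ v₂)
    (hu : u₁.length ≡ u₂.length [MOD 6 * blockLength k]) {w : Stream' α}
    (hw : IsDecomposition w u₁
      (v₁.take (3 * blockLength k) ++ v₂.drop (3 * blockLength k))) :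
    w ∈ (wheel (k + 2) b).omegaLanguage := by
  have hP := two_le_blockLength (k := k)
  have hl₁ := h₁.le_length hab
  have hl₂ := h₂.le_length hab
  have hshift : ∀ m s, u₁.length + (v₂.length * m + s) ≡ u₁.length + s
      [MOD 6 * blockLength k] := by
    intro m s
    refine Nat.ModEq.add_left _ ?_
    simpa using Nat.ModEq.add_right s
      ((Nat.modEq_zero_iff_dvd.2 (h₂.dvd_length hab)).mul_right m)
  have hlen : (v₁.take (3 * blockLength k) ++ v₂.drop (3 * blockLength k)).length =
      v₂.length := by
    simp only [List.length_append, List.length_take, List.length_drop]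
    omega
  have hmod : ∀ m s, s < v₂.length → (v₂.length * m + s) %
      (v₁.take (3 * blockLength k) ++ v₂.drop (3 * blockLength k)).length = s := by
    intro m s hs
    rw [hlen, Nat.mul_add_mod, Nat.mod_eq_of_lt hs]
  -- Loop lengths are multiples of `6 * blockLength k`, so every round agrees with the order words
  -- at the same absolute positions; for `σ` this also needs the congruence of the prefix lengths.
  have hgetπ : ∀ m s, s < 3 * blockLength k →
      w.get (u₁.length + (v₂.length * m + s)) =
        (orderWord a b π).get (u₁.length + (v₂.length * m + s)) := by
    intro m s hs
    rw [orderWord_get_congr π (hshift m s), hw.get_add, h₁.get_add]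
    simp only [hmod m s (by omega), Nat.mod_eq_of_lt (show s < v₁.length by omega)]
    rw [List.getElem_append_left (by simp only [List.length_take]; omega), List.getElem_take]
  have hgetσ : ∀ m s, 3 * blockLength k ≤ s → s < v₂.length →
      w.get (u₁.length + (v₂.length * m + s)) =
        (orderWord a b σ).get (u₁.length + (v₂.length * m + s)) := by
    intro m s hs hs'
    rw [orderWord_get_congr σ ((hshift m s).trans (hu.add_right s)), hw.get_add, h₂.get_add]
    simp only [hmod m s hs', Nat.mod_eq_of_lt hs']
    rw [List.getElem_append_right (by simp only [List.length_take]; omega), List.getElem_drop]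
    congr 1
    simp only [List.length_take]
    omega
  have hlarge : ∀ N, blockLength k * N ≤ v₂.length * (blockLength k * N) := fun N =>
    Nat.le_mul_of_pos_left _ (by omega)
  obtain ⟨i, j, hi, hj⟩ := exists_lt_and_lt_of_ne hne
  refine mem_wheel_of_frequently hi hj (fun N => ?_) (fun N => ?_)
  · obtain ⟨m, hm, hlo, hhi⟩ :=
      exists_block_between k (u₁.length + v₂.length * (blockLength k * N))
    have := hlarge N
    refine ⟨m, le_of_mul_le_mul_left (by omega) (show 0 < blockLength k by omega),
      fun t ht => ?_⟩
    obtain ⟨s, hs⟩ := Nat.exists_eq_add_of_le hlo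
    have e : blockLength k * m + t =
      u₁.length + (v₂.length * (blockLength k * N) + (s + t)) := by omega
    rw [e, hgetπ _ _ (by omega), ← e, orderWord_block_eq_iff π hab m ht]
    simp [hm]
  · obtain ⟨m, hm, hlo, hhi⟩ := exists_block_between k
      (u₁.length + v₂.length * (blockLength k * N) + 3 * blockLength k)
    have := hlarge N
    refine ⟨m, le_of_mul_le_mul_left (by omega) (show 0 < blockLength k by omega),
      fun t ht => ?_⟩
    obtain ⟨s, hs⟩ := Nat.exists_eq_add_of_le hlo
    have e : blockLength k * m + t =
      u₁.length + (v₂.length * (blockLength k * N) + (3 * blockLength k + s + t)) := by omega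
    rw [e, hgetσ _ _ (by omega) (by omega), ← e, orderWord_block_eq_iff σ hab m ht]
    simp [hm]

end Splice

/-- At the cut both the leading and the progress automaton are in the same state for the two words,
so the second tail can be read after the first head. No saturation is needed. -/
theorem FDFW.normalized_and_captures_splice {α : Type*} {𝓕 : FDFW α} {u₁ v₁ u₂ v₂ : List α} {c : ℕ}
    {q d : 𝓕.Lead} {e : 𝓕.Prog q} (hu₁ : 𝓕.leading.eval u₁ = {q})
    (huv₂ : 𝓕.leading.eval (u₂ ++ v₂) = {q}) (hv₂ : v₂ ∈ (𝓕.progress q).accepts)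
    (hd₁ : 𝓕.leading.eval (u₁ ++ v₁.take c) = {d}) (hd₂ : 𝓕.leading.eval (u₂ ++ v₂.take c) = {d})
    (he₁ : (𝓕.progress q).eval (v₁.take c) = {e}) (he₂ : (𝓕.progress q).eval (v₂.take c) = {e}) :
    𝓕.Normalized u₁ (v₁.take c ++ v₂.drop c) ∧ 𝓕.Captures u₁ (v₁.take c ++ v₂.drop c) := by
  constructor
  · rw [FDFW.Normalized, hu₁, ← List.append_assoc, NFA.eval_append, hd₁, ← hd₂,
      ← NFA.eval_append, List.append_assoc, List.take_append_drop, huv₂]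
  · refine ⟨q, hu₁, ?_⟩
    obtain ⟨s, hs, hs'⟩ := hv₂
    refine ⟨s, hs, ?_⟩
    rwa [NFA.eval_append, he₁, ← he₂, ← NFA.eval_append, List.take_append_drop]

theorem FDFW.factorial_le_of_accepts_wheel {α : Type*} {a b : α} (hab : a ≠ b) {k : ℕ}
    {𝓕 : FDFW α} (h𝓕 : 𝓕.Accepts (wheel (k + 2) b).omegaLanguageᶜ) :
    k.factorial ≤ 𝓕.numMacrostates ^ 2 * (6 * blockLength k) := by
  have hP := two_le_blockLength (k := k)
  have hacc : ∀ π : Equiv.Perm (Fin k), ∃ (z : Σ q, 𝓕.Prog q) (d : 𝓕.Lead)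
      (r : Fin (6 * blockLength k)) (u v : List α),
      IsDecomposition (orderWord a b π) u v ∧ u.length % (6 * blockLength k) = r ∧
      𝓕.leading.eval u = {z.1} ∧ 𝓕.leading.eval (u ++ v) = {z.1} ∧
      v ∈ (𝓕.progress z.1).accepts ∧
      𝓕.leading.eval (u ++ v.take (3 * blockLength k)) = {d} ∧
      (𝓕.progress z.1).eval (v.take (3 * blockLength k)) = {z.2} := by
    intro π
    have hmem : orderWord a b π ∈ 𝓕.upLanguage := by
      rw [h𝓕]
      exact ⟨orderWord_notMem π hab, _, _, isDecomposition_nil_take (p := 6 * blockLength k)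
        (by omega) fun i => orderWord_get_congr π (Nat.mod_modEq _ _).symm⟩
    obtain ⟨u, v, hdec, hnorm, q, hq, hv⟩ := hmem
    have huv : 𝓕.leading.eval (u ++ v) = {q} := hnorm.symm.trans hq
    obtain ⟨d, hd⟩ := 𝓕.leading_deterministic.exists_eval_eq_singleton
      (x := u ++ v.take (3 * blockLength k)) (y := v.drop (3 * blockLength k))
      (by rw [List.append_assoc, List.take_append_drop, huv]; exact Set.singleton_nonempty q)
    obtain ⟨e, he⟩ := (𝓕.progress_deterministic q).exists_eval_eq_singleton
      (x := v.take (3 * blockLength k)) (y := v.drop (3 * blockLength k))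
      (by rw [List.take_append_drop]; exact ⟨hv.choose, hv.choose_spec.2⟩)
    exact ⟨⟨q, e⟩, d, ⟨_, Nat.mod_lt _ (by omega)⟩, u, v, hdec, rfl, hq, huv, hv, hd, he⟩
  choose z d r u v hdec hr hu huv hv hd he using hacc
  have hinj : Function.Injective fun π => (d π, z π, r π) := by
    intro π σ heq
    by_contra hne
    simp only [Prod.mk.injEq] at heq
    obtain ⟨hdd, hzz, hrr⟩ := heq
    have huv₂ := huv σ
    have hv₂ := hv σ
    have hd₂ := hd σ
    have he₂ := he σ
    rw [← hzz] at huv₂ hv₂ he₂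
    rw [← hdd] at hd₂
    obtain ⟨hn, hc⟩ := FDFW.normalized_and_captures_splice (hu π) huv₂ hv₂ (hd π) hd₂ (he π) he₂
    have hne' : (v π).take (3 * blockLength k) ++ (v σ).drop (3 * blockLength k) ≠ [] := by
      have := (hdec σ).le_length hab
      rw [← List.length_pos_iff, List.length_append, List.length_drop]
      omega
    have hdecW : IsDecomposition (u π ++ₛ Stream'.cycle _ hne') (u π) _ := ⟨hne', rfl⟩
    have hW : u π ++ₛ Stream'.cycle _ hne' ∈ 𝓕.upLanguage := ⟨_, _, hdecW, hn, hc⟩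
    rw [h𝓕] at hW
    refine hW.1 (splice_mem_wheel hab hne (hdec π) (hdec σ) ?_ hdecW)
    rw [Nat.ModEq, hr, hr, hrr]
  have hcard := Fintype.card_le_of_injective _ hinj
  rw [Fintype.card_perm, Fintype.card_fin, Fintype.card_prod, Fintype.card_prod,
    Fintype.card_sigma, Fintype.card_fin, ← mul_assoc] at hcard
  refine hcard.trans (Nat.mul_le_mul_right _ ?_)
  rw [sq]
  exact Nat.mul_le_mul (Nat.le_add_right _ _) (Nat.le_add_left _ _)

/-! ### From the factorial to the exponential bound -/

/-- This is the logarithm of `k ^ k / k! ≤ exp k`, a single term of the exponential series. -/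
theorem Real.mul_log_sub_le_log_factorial {k : ℕ} (hk : 0 < k) :
    k * Real.log k - k ≤ Real.log k.factorial := by
  have h := Real.pow_div_factorial_le_exp (k : ℝ) (by positivity) k
  have hk' : (0 : ℝ) < k := by exact_mod_cast hk
  have h2 := Real.log_le_log (by positivity) h
  rw [Real.log_exp, Real.log_div (by positivity) (by positivity), Real.log_pow] at h2
  linarith

/-- A number whose square is at least `k!` up to a quadratic factor is at least
`2 ^ (n * log n / 8)` for `n = k + 4`. -/
theorem two_rpow_le_of_factorial_le {k m : ℕ} (hk : Real.exp 8 + 24 ≤ ((k + 4 : ℕ) : ℝ))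
    (h : k.factorial ≤ m ^ 2 * (6 * blockLength k)) :
    (2 : ℝ) ^ (1 / 8 * (((k + 4 : ℕ) : ℝ) * Real.log (k + 4 : ℕ))) ≤ m := by
  have hexp := Real.exp_pos 8
  obtain ⟨n, hn⟩ : ∃ n : ℝ, n = ((k + 4 : ℕ) : ℝ) := ⟨_, rfl⟩
  rw [← hn] at hk ⊢
  have hkn : (k : ℝ) = n - 4 := by rw [hn]; push_cast; ring
  have hn0 : 0 < n := by linarith
  have hk0 : 0 < k := by
    have : (0 : ℝ) < k := by linarith
    exact_mod_cast this
  have hm : 0 < m := by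
    rcases Nat.eq_zero_or_pos m with rfl | hm
    · have := k.factorial_pos
      omega
    · exact hm
  have hm' : (0 : ℝ) < m := by exact_mod_cast hm
  have hlog : 8 ≤ Real.log n := by
    rw [Real.le_log_iff_exp_le hn0]; linarith
  have hfac : (k.factorial : ℝ) ≤ m ^ 2 * n ^ 3 := by
    have h1 : (k.factorial : ℝ) ≤ m ^ 2 * (6 * ((k + 2) * (k + 1))) := by
      have := (Nat.cast_le (α := ℝ)).2 h
      unfold blockLength at this
      push_cast at this
      exact this
    refine h1.trans (mul_le_mul_of_nonneg_left ?_ (by positivity))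
    rw [hkn]
    nlinarith [mul_nonneg hn0.le (show 0 ≤ n - 6 by linarith),
      mul_nonneg (mul_nonneg hn0.le hn0.le) (show 0 ≤ n - 6 by linarith)]
  have h1 := (Real.mul_log_sub_le_log_factorial hk0).trans
    (Real.log_le_log (by positivity) hfac)
  rw [Real.log_mul (by positivity) (by positivity), Real.log_pow, Real.log_pow, hkn] at h1
  push_cast at h1
  have h2 : Real.log n - 1 ≤ Real.log (n - 4) := by
    have : Real.log (n / 2) ≤ Real.log (n - 4) :=
      Real.log_le_log (by positivity) (by linarith)
    rw [Real.log_div hn0.ne' two_ne_zero] at this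
    linarith [Real.log_two_lt_d9]
  -- The loss of 2 in the logarithm is at most a quarter of it, because `8 ≤ log n`.
  have h3 : n / 2 * (3 / 4 * Real.log n) ≤ (n - 4) * (Real.log (n - 4) - 1) :=
    mul_le_mul (by linarith) (by linarith) (by linarith) (by linarith)
  have h4 : 3 * Real.log n ≤ n / 8 * Real.log n :=
    mul_le_mul_of_nonneg_right (by linarith) (by linarith)
  -- The factorial contributes `3 / 8` and the cubic factor costs `1 / 8` of `n * log n`; the square
  -- of `m` halves the remaining quarter.
  have h5 : n * Real.log n / 8 ≤ Real.log m := by linarith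
  rw [← Real.log_le_log_iff (by positivity) hm', Real.log_rpow two_pos]
  refine le_trans ?_ h5
  have h6 : 0 ≤ n * Real.log n := mul_nonneg hn0.le (by linarith)
  nlinarith [Real.log_two_lt_d9]

theorem mainTheorem4 {α : Type*} [Nontrivial α] :
    ∃ A : (n : ℕ) → NFA α (Fin n), ∃ c : ℝ, 0 < c ∧ ∃ N : ℕ, ∀ n ≥ N, ∀ 𝓕 : FDFW α,
      𝓕.Accepts (A n).omegaLanguageᶜ →
        (2 : ℝ) ^ (c * (n * Real.log n)) ≤ (𝓕.numMacrostates : ℝ) := by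
  obtain ⟨a, b, hab⟩ := exists_pair_ne α
  refine ⟨fun n => match n with
    | k + 4 => (wheel (k + 2) b).mapEquiv (WheelState.equivFin (k + 2))
    -- The cases `n < 4` lie below the threshold, so any automaton serves there.
    | _ => ⟨fun _ _ => ∅, ∅, ∅⟩, 1 / 8, by norm_num, ⌈Real.exp 8⌉₊ + 24, fun n hn 𝓕 h𝓕 => ?_⟩
  obtain ⟨k, rfl⟩ : ∃ k, n = k + 4 := ⟨n - 4, by omega⟩
  have hacc : 𝓕.Accepts (wheel (k + 2) b).omegaLanguageᶜ := by
    simpa only [NFA.omegaLanguage_mapEquiv] using h𝓕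
  refine two_rpow_le_of_factorial_le ?_ (FDFW.factorial_le_of_accepts_wheel hab hacc)
  have h1 := Nat.le_ceil (Real.exp 8)
  have h2 : ((⌈Real.exp 8⌉₊ + 24 : ℕ) : ℝ) ≤ ((k + 4 : ℕ) : ℝ) := Nat.cast_le.2 hn
  push_cast at h2 ⊢
  linarith
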